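/- Let $d$ be a fixed positive integer. In the problem DA($d$), the input is a finite connected simple undirected graph $G$, and the question is whether there is a set $F\subseteq E(G)$ such that $G-F$ (the graph with vertex set $V(G)$ and edge set $E(G)\setminus F$) is a connected graph of diameter at least $d$, where the diameter is the maximum distance between two vertices. Then, for every positive integer $d$, the problem DA($d$) is solvable in polynomial time: there are a deterministic (multi-stack) Turing machine $M_d$ with finite alphabets and a polynomial $p_d$ such that, for every finite connected graph $G$ with vertex set $\{0,\dots,n-1\}$, the machine $M_d$, given the adjacency matrix of $G$ written row by row, halts within $p_d(\ell)$ steps, where $\ell$ is the length of this input, and outputs whether $G$ is a yes instance of DA($d$). -/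

import Mathlib

open Computability Turing

/-- The finite connected simple graphs, presented (as inputs of algorithms) with vertex set
`{0, …, n - 1}`. In Mathlib `Connected` includes that there is at least one vertex. -/
structure ConnectedGraph where
  /-- the number of vertices -/
  n : ℕ
  /-- the graph itself -/
  graph : SimpleGraph (Fin n)
  connected : graph.Connected

namespace ConnectedGraph

open Classical in
/-- The adjacency matrix, written row by row: the row of the vertex `i` is the list of the bits
`some b`, where `b` says whether `i` and `j` are adjacent (`j = 0, …, n - 1`), followed by the
end-of-row symbol `none`. -/
noncomputable def adjacencyString (G : ConnectedGraph) : List (Option Bool) :=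
  (List.finRange G.n).flatMap fun i =>
    (List.finRange G.n).map (fun j => some (decide (G.graph.Adj i j))) ++ [none]

theorem eq_of_flatMap_eq {α β : Type} (f g : α → List β) (hlen : ∀ x, (f x).length = (g x).length) :
    ∀ l : List α, l.flatMap f = l.flatMap g → ∀ x ∈ l, f x = g x := by
  intro l
  induction l with
  | nil => simp
  | cons a l ih =>
    intro h x hx
    rw [List.flatMap_cons, List.flatMap_cons] at h
    obtain ⟨h1, h2⟩ := List.append_inj h (hlen a)
    rcases List.mem_cons.1 hx with rfl | hx
    · exact h1
    · exact ih h2 x hx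

theorem length_adjacencyString (G : ConnectedGraph) :
    G.adjacencyString.length = G.n * (G.n + 1) := by
  simp [adjacencyString, List.length_flatMap]

theorem adjacencyString_injective : Function.Injective adjacencyString := by
  rintro ⟨n, G, hG⟩ ⟨m, H, hH⟩ h
  have hlen := congrArg List.length h
  rw [length_adjacencyString, length_adjacencyString] at hlen
  have hnm : n = m := by
    dsimp only at hlen
    rcases lt_trichotomy n m with h | h | h
    · nlinarith
    · exact h
    · nlinarith
  subst hnm
  have key := eq_of_flatMap_eq _ _ (by simp) _ h
  have hGH : G = H := by
    ext i j
    have hi := key i (List.mem_finRange i)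
    rw [List.append_cancel_right_eq] at hi
    simpa using List.map_inj_left.1 hi j (List.mem_finRange j)
  subst hGH
  rfl

open Classical in
/-- The encoding of connected graphs by their adjacency matrices, over a three-letter alphabet. -/
noncomputable def encoding : Encoding ConnectedGraph (Option Bool) where
  encode := adjacencyString
  decode w := if h : ∃ G, adjacencyString G = w then some h.choose else none
  decode_encode G := by
    have h : ∃ H, adjacencyString H = adjacencyString G := ⟨G, rfl⟩
    rw [dif_pos h]
    exact congrArg some (adjacencyString_injective h.choose_spec)

end ConnectedGraph

/-- `G` is a yes instance of the problem DA(d): some set `F` of edges of `G` can be deleted such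
that `G - F` is a connected graph of diameter at least `d`. (For finite connected graphs, `diam` is
the maximum of the distances.) -/
def IsYesInstanceDA (d : ℕ) (G : ConnectedGraph) : Prop :=
  ∃ F : Set (Sym2 (Fin G.n)), F ⊆ G.graph.edgeSet ∧
    (G.graph.deleteEdges F).Connected ∧ d ≤ (G.graph.deleteEdges F).diam

open Classical in
/-- The decision problem with instances `a : α`, encoded by `e`, and question `P a` is solvable in
polynomial time: some multi-stack Turing machine (all of whose alphabets are finite), started on the
encoding of any instance `a`, outputs the truth value of `P a` within a number of steps that is
bounded by a fixed polynomial in the length of the encoding of `a`. -/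
def SolvableInPolyTime {α Γ : Type} (e : Encoding α Γ) (P : α → Prop) : Prop :=
  ∃ M : TM2ComputableInPolyTime e.encode encodeBool (fun a => decide (P a)),
    ∀ k, Finite (M.tm.Γ k)

/-! A connected `G - F` of diameter at least `d` contains a shortest path with at least `d + 1`
vertices, and this is a path of `G`. Conversely, a path of `G` with `d + 1` vertices extends to a
spanning tree, in which it is the only path between its ends; deleting all edges outside the tree
leaves diameter at least `d`. So the question is whether `G` has a path on `k = d + 1` vertices
(`isYesInstanceDA_iff_exists_path`), and since `k` is fixed, all `n ^ k` sequences of vertices can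
be tried.

The machine records a candidate by marks on the cells of the adjacency matrix and treats it as a
`k`-digit number in base `n`. A sweep from right to left subtracts 1 (`shifted_marks_digits`); a
sweep from left to right tests the result (`accepts_sweep_forward_tape_iff`). The countdown starts
at `n ^ k`, whose last `k` digits are 0, and stops at the latest when 0 has been tested
(`reaches_answer`). Each round is linear in the input length. -/

/-! ### Reduction to the existence of a path -/

namespace SimpleGraph

variable {V : Type*} {G : SimpleGraph V}

/-- A path in `G`, given by its sequence of vertices, is a path in an acyclic subgraph of `G`. -/
theorem exists_isAcyclic_isPath_of_injOn {v : ℕ → V} {d : ℕ} (hinj : Set.InjOn v (Set.Iic d))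
    (hadj : ∀ i < d, G.Adj (v i) (v (i + 1))) :
    ∃ H ≤ G, H.IsAcyclic ∧ (∀ x y, H.Adj x y → x ∈ v '' Set.Iic d) ∧
      ∃ p : H.Walk (v 0) (v d), p.IsPath ∧ p.length = d ∧ ∀ x ∈ p.support, x ∈ v '' Set.Iic d := by
  induction d with
  | zero => exact ⟨⊥, bot_le, isAcyclic_bot, by simp, .nil, by simp⟩
  | succ d ih =>
    obtain ⟨H, hHG, hac, hsupp, p, hp, hlen, hps⟩ := ih
      (hinj.mono (Set.Iic_subset_Iic.2 d.le_succ)) fun i hi => hadj i (hi.trans d.lt_succ_self)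
    have hnot : v (d + 1) ∉ v '' Set.Iic d := by
      rintro ⟨j, hj, hjd⟩
      have := hinj (Set.mem_Iic.2 ((Set.mem_Iic.1 hj).trans d.le_succ)) (Set.mem_Iic.2 le_rfl) hjd
      simp at hj
      omega
    have hsub : v '' Set.Iic d ⊆ v '' Set.Iic (d + 1) :=
      Set.image_mono (Set.Iic_subset_Iic.2 d.le_succ)
    have hne : v d ≠ v (d + 1) := (hadj d d.lt_succ_self).ne
    have hadj' : (H ⊔ edge (v d) (v (d + 1))).Adj (v d) (v (d + 1)) :=
      Or.inr ((edge_adj _ _ _ _).2 ⟨Or.inl ⟨rfl, rfl⟩, hne⟩)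
    refine ⟨H ⊔ edge (v d) (v (d + 1)), sup_le hHG ?_, ?_, ?_,
      (p.mapLe le_sup_left).concat hadj', ?_, by simp [hlen], ?_⟩
    · intro x y hxy
      rcases (edge_adj _ _ _ _).1 hxy with ⟨⟨rfl, rfl⟩ | ⟨rfl, rfl⟩, -⟩
      · exact hadj d d.lt_succ_self
      · exact (hadj d d.lt_succ_self).symm
    -- The new vertex is isolated in `H`, so the new edge closes no cycle.
    · refine hac.sup_edge_of_not_reachable fun ⟨q⟩ => ?_
      obtain ⟨_, h, -⟩ := q.reverse.exists_eq_cons_of_ne hne.symm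
      exact hnot (hsupp _ _ h)
    · rintro x y (h | h)
      · exact hsub (hsupp x y h)
      · rcases (edge_adj _ _ _ _).1 h with ⟨⟨rfl, rfl⟩ | ⟨rfl, rfl⟩, -⟩
        · exact ⟨d, by simp, rfl⟩
        · exact ⟨d + 1, by simp, rfl⟩
    · refine Walk.IsPath.concat (by simpa using hp) (fun h => hnot (hps _ (by simpa using h))) _
    · intro x hx
      rw [Walk.support_concat, List.mem_append] at hx
      rcases hx with hx | hx
      · exact hsub (hps x (by simpa using hx))
      · exact ⟨d + 1, by simp, (List.mem_singleton.1 hx).symm⟩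

end SimpleGraph

theorem isYesInstanceDA_iff_exists_path (d : ℕ) (G : ConnectedGraph) :
    IsYesInstanceDA d G ↔ ∃ v : Fin (d + 1) → Fin G.n, Function.Injective v ∧
      ∀ a b : Fin (d + 1), (a : ℕ) + 1 = b → G.graph.Adj (v a) (v b) := by
  have := G.connected.nonempty
  constructor
  · rintro ⟨F, -, hconn, hd⟩
    obtain ⟨u, w, huw⟩ := (G.graph.deleteEdges F).exists_dist_eq_diam
    obtain ⟨p, hp, hlen⟩ := hconn.exists_path_of_dist u w
    refine ⟨fun a => p.getVert a, fun a b hab => ?_, fun a b hab => ?_⟩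
    · have ha := a.2
      have hb := b.2
      exact Fin.ext (hp.getVert_injOn (by simp; omega) (by simp; omega) hab)
    · have hb := b.2
      simp only [← hab]
      exact SimpleGraph.deleteEdges_le F (p.adj_getVert_succ (by omega))
  · rintro ⟨v, hinj, hadj⟩
    obtain ⟨H, hHG, hac, -, p, hp, hlen, -⟩ := SimpleGraph.exists_isAcyclic_isPath_of_injOn
      -- `Fin.ofNat` only extends `v` to all of `ℕ`; indices up to `d` are unchanged.
      (G := G.graph) (v := fun i => v (Fin.ofNat (d + 1) i)) (d := d)
      (fun i hi j hj hij => by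
        have := congrArg Fin.val (hinj hij)
        simp only [Set.mem_Iic] at hi hj
        simpa [Nat.mod_eq_of_lt (Nat.lt_succ_of_le hi), Nat.mod_eq_of_lt (Nat.lt_succ_of_le hj)]
          using this)
      (fun i hi => hadj _ _ (by
        simp [Nat.mod_eq_of_lt (hi.trans d.lt_succ_self), Nat.mod_eq_of_lt (Nat.succ_lt_succ hi)]))
    obtain ⟨T, hHT, hTG, hT⟩ := G.connected.exists_isTree_le_of_le_of_isAcyclic hHG hac
    refine ⟨G.graph.edgeSet \ T.edgeSet, Set.sdiff_subset, ?_⟩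
    have hdel : G.graph.deleteEdges (G.graph.edgeSet \ T.edgeSet) = T := by
      ext x y
      have := @hTG x y
      simp only [SimpleGraph.deleteEdges_adj, Set.mem_sdiff, SimpleGraph.mem_edgeSet]
      tauto
    rw [hdel]
    refine ⟨hT.1, ?_⟩
    obtain ⟨q, hq, hqlen⟩ := hT.1.exists_path_of_dist
      (v (Fin.ofNat (d + 1) 0)) (v (Fin.ofNat (d + 1) d))
    have hpq := congrArg (fun r : T.Path _ _ => r.1.length)
      ((hT.2.subsingleton_path _ _).elim ⟨q, hq⟩ ⟨p.mapLe hHT, by simpa using hp⟩)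
    simp only [SimpleGraph.Walk.length_map, SimpleGraph.Walk.mapLe, hlen, hqlen] at hpq
    rw [← hpq]
    -- `diam` takes the value 0 when `ediam` is infinite, so finiteness is needed here; it comes
    -- from connectedness.
    exact SimpleGraph.dist_le_diam (SimpleGraph.connected_iff_ediam_ne_top.1 hT.1)

/-! ### Time-bounded reachability -/

/-- `f` leads from `a` to `b` in at most `m` steps. -/
def ReachesInTime {σ : Type*} (f : σ → Option σ) (m : ℕ) (a b : σ) : Prop :=
  Nonempty (StateTransition.EvalsToInTime f a (some b) m)

namespace ReachesInTime

variable {σ : Type*} {f : σ → Option σ} {a b c : σ} {m n : ℕ}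

theorem refl (a : σ) : ReachesInTime f 0 a a := ⟨.refl f a⟩

theorem trans (h₁ : ReachesInTime f m a b) (h₂ : ReachesInTime f n b c) :
    ReachesInTime f (m + n) a c :=
  h₁.elim fun h₁ => h₂.elim fun h₂ => ⟨Nat.add_comm n m ▸ .trans f m n a b _ h₁ h₂⟩

theorem mono (h : ReachesInTime f m a b) (hmn : m ≤ n) : ReachesInTime f n a b :=
  h.elim fun h => ⟨⟨h.toEvalsTo, h.steps_le_m.trans hmn⟩⟩

theorem congr {a' b' : σ} (h : ReachesInTime f m a b) (ha : a = a') (hb : b = b') :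
    ReachesInTime f m a' b' := ha ▸ hb ▸ h

theorem single (h : f a = some b) : ReachesInTime f 1 a b := ⟨⟨⟨1, h⟩, le_rfl⟩⟩

theorem head (h : f a = some b) (h₂ : ReachesInTime f m b c) : ReachesInTime f (m + 1) a c :=
  Nat.add_comm 1 m ▸ (single h).trans h₂

end ReachesInTime

/-! ### The machine and the run time of its phases -/

namespace PathMachine

/-- A set of the `k` vertices of a candidate for a path. -/
abbrev Marks (k : ℕ) : Type := Fin k → Bool

/-- A symbol of an adjacency matrix, together with the set of the candidate's vertices that belong
to its column (for an entry of the matrix) or to its row (for an end of a row). -/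
abbrev Cell (k : ℕ) : Type := Option Bool × Marks k

/-- The stacks: the input stack, the two sides of the work tape, and the output stack. -/
inductive Stack
  | input | left | right | output
  deriving DecidableEq

instance : Fintype Stack :=
  ⟨{.input, .left, .right, .output}, fun s => by cases s <;> simp⟩

/-- The alphabets of the stacks. -/
def Alphabet (k : ℕ) : Stack → Type
  | .input => Option Bool
  | .left => Cell k
  | .right => Cell k
  | .output => Bool

/-- The labels: the input is copied to the work tape, which is then swept alternately in both
directions; in the end it is erased. -/
inductive Label
  | setup | backward | forward | clear (answer : Bool)
  deriving Fintype

/-- The registers of the machine: four sets of the candidate's vertices, whose use depends on the label,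
and a relation on the candidate's vertices. -/
structure Registers (k : ℕ) where
  /-- the set of the candidate's vertices that are the first vertex of the graph -/
  first : Marks k
  /-- information about the current column -/
  col : Marks k
  /-- information about the current row -/
  row : Marks k
  /-- additional information -/
  extra : Marks k
  /-- the adjacencies found -/
  adj : Fin k → Fin k → Bool

/-- The internal states of the machine: the registers and the result of the latest `pop`. -/
abbrev State (k : ℕ) : Type := Registers k × Option (Cell k)

variable {k : ℕ}

instance : Finite (Registers k) :=
  Finite.of_injective (fun r => (r.first, r.col, r.row, r.extra, r.adj)) fun r s h => by
    cases r
    cases s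
    simpa using h

/-- The contents of the stacks. -/
def contents (i : List (Option Bool)) (l r : List (Cell k)) (o : List Bool) :
    ∀ s, List (Alphabet k s)
  | .input => i
  | .left => l
  | .right => r
  | .output => o

section contents

variable (i i' : List (Option Bool)) (l l' r r' : List (Cell k)) (o o' : List Bool)

theorem update_contents_input :
    Function.update (contents i l r o) .input i' = contents i' l r o := by
  funext s; cases s <;> rfl

theorem update_contents_left :
    Function.update (contents i l r o) .left l' = contents i l' r o := by
  funext s; cases s <;> rfl

theorem update_contents_right :
    Function.update (contents i l r o) .right r' = contents i l r' o := by
  funext s; cases s <;> rfl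

theorem update_contents_output :
    Function.update (contents i l r o) .output o' = contents i l r o' := by
  funext s; cases s <;> rfl

end contents

/-- The action on the next symbol of the input: the candidate's vertices are all placed at the first
vertex of the graph. -/
def setupStep (s : Registers k) : Cell k → Registers k × Cell k
  | (some b, _) => ({ s with col := ⊥ }, (some b, s.col))
  | (none, _) => ({ s with col := ⊤, row := ⊥ }, (none, s.row))

/-- The candidate's vertex `a` is moved cyclically to the preceding vertex of the graph if all the
earlier ones are at the first vertex of the graph. -/
def shift (first new old : Marks k) : Marks k :=
  fun a => if ∀ b < a, first b then new a else old a

/-- The action on the next cell of the tape in a sweep from right to left. -/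
def backwardStep (s : Registers k) : Cell k → Registers k × Cell k
  | (some b, m) =>
    ({ s with col := m, extra := shift s.first s.col m }, (some b, shift s.first s.col m))
  | (none, m) => ({ s with row := m }, (none, shift s.first s.row m))

/-- The action on the next cell of the tape in a sweep from left to right: `col` collects the
candidate's vertices that are neighbours of the current row, `extra` the ones that coincide with
another one. -/
def forwardStep (s : Registers k) : Cell k → Registers k × Cell k
  | (some b, m) => ({ s with col := fun a => s.col a || (b && m a) }, (some b, m))
  | (none, m) =>
    ({ s with
        col := ⊥
        extra := fun a => s.extra a || (m a && decide (∃ b ≠ a, m b))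
        adj := fun a b => s.adj a b || (m a && s.col b) }, (none, m))

/-- The test of the candidate. -/
def Accepts (s : Registers k) : Prop :=
  s.extra = ⊥ ∧ ∀ a b : Fin k, (a : ℕ) + 1 = b → s.adj a b

instance : DecidablePred (Accepts (k := k)) := fun _ => inferInstanceAs (Decidable (_ ∧ _))

/-- The registers at the beginning of a sweep from right to left. -/
def backwardStart (z : Marks k) : Registers k := ⟨z, z, z, ⊥, ⊥⟩

/-- The registers at the beginning of a sweep from left to right. -/
def forwardStart (z : Marks k) : Registers k := ⟨z, ⊥, ⊥, ⊥, ⊥⟩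

/-- The registers at the beginning of the computation. -/
def initialRegisters (k : ℕ) : Registers k := ⟨⊤, ⊤, ⊤, ⊥, ⊥⟩

/-- The program that moves the next symbol from a stack to another one. -/
def sweepStmt (src dst : Stack) (read : Alphabet k src → Cell k) (write : Cell k → Alphabet k dst)
    (step : Registers k → Cell k → Registers k × Cell k) (l : Label)
    (q : TM2.Stmt (Alphabet k) Label (State k)) : TM2.Stmt (Alphabet k) Label (State k) :=
  .pop src (fun s x => (s.1, x.map read)) <|
    .branch (fun s => s.2.isSome)
      (.push dst (fun s => write (step s.1 (s.2.getD (none, ⊥))).2) <|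
        .load (fun s => ((step s.1 (s.2.getD (none, ⊥))).1, none)) <| .goto fun _ => l)
      q

/-- The program of the machine. -/
def program (k : ℕ) : Label → TM2.Stmt (Alphabet k) Label (State k)
  | .setup =>
    sweepStmt .input .left (fun x : Option Bool => (x, ⊥)) id setupStep .setup <|
      .load (fun s => (backwardStart s.1.first, none)) <| .goto fun _ => .backward
  | .backward =>
    sweepStmt .left .right id id backwardStep .backward <|
      .load (fun s => (forwardStart s.1.extra, none)) <| .goto fun _ => .forward
  | .forward =>
    sweepStmt .right .left id id forwardStep .forward <|
      .branch (fun s => decide (Accepts s.1)) (.goto fun _ => .clear true) <|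
        .branch (fun s => decide (s.1.first = ⊤)) (.goto fun _ => .clear false) <|
          .load (fun s => (backwardStart s.1.first, none)) <| .goto fun _ => .backward
  | .clear b =>
    .pop .left (fun s x => (s.1, x)) <|
      .branch (fun s => s.2.isSome) (.goto fun _ => .clear b) <|
        .push .output (fun _ => b) <| .load (fun _ => (initialRegisters k, none)) .halt

/-- The machine. -/
noncomputable def machine (k : ℕ) : FinTM2 where
  K := Stack
  k₀ := .input
  k₁ := .output
  Γ := Alphabet k
  Λ := Label
  main := .setup
  σ := State k
  initialState := (initialRegisters k, none)
  σFin := Fintype.ofFinite _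
  Γk₀Fin := inferInstanceAs (Fintype (Option Bool))
  m := program k

/-- A configuration of the machine. -/
def cfg (l : Label) (s : Registers k) (i : List (Option Bool)) (left right : List (Cell k)) :
    TM2.Cfg (Alphabet k) Label (State k) :=
  ⟨some l, (s, none), contents i left right []⟩

/-- The effect of a sweep: the final registers and the cells written, the last one first. -/
def sweep (step : Registers k → Cell k → Registers k × Cell k) :
    Registers k → List (Cell k) → List (Cell k) → Registers k × List (Cell k)
  | s, [], acc => (s, acc)
  | s, c :: l, acc => sweep step (step s c).1 l ((step s c).2 :: acc)

section step

variable {src dst : Stack} {read : Alphabet k src → Cell k} {write : Cell k → Alphabet k dst}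
  {step : Registers k → Cell k → Registers k × Cell k} {l : Label}
  {q : TM2.Stmt (Alphabet k) Label (State k)} {s : Registers k} {S : ∀ s, List (Alphabet k s)}

theorem stepAux_sweepStmt_nil (h : S src = []) :
    TM2.stepAux (sweepStmt src dst read write step l q) (s, none) S = TM2.stepAux q (s, none) S := by
  have hS : Function.update S src [] = S := by rw [← h, Function.update_eq_self]
  simp [sweepStmt, h, hS]

theorem stepAux_sweepStmt_cons {x : Alphabet k src} {xs : List (Alphabet k src)}
    (h : S src = x :: xs) (hsd : dst ≠ src) :
    TM2.stepAux (sweepStmt src dst read write step l q) (s, none) S =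
      ⟨some l, ((step s (read x)).1, none), Function.update (Function.update S src xs) dst
        (write (step s (read x)).2 :: S dst)⟩ := by
  simp [sweepStmt, h, hsd]

end step

/-- One machine step executes the whole statement of a label, hence one step per symbol; the
additional step meets the empty stack and changes the phase. -/
theorem reaches_setup (s : Registers k) (i : List (Option Bool)) (acc : List (Cell k)) :
    ReachesInTime (TM2.step (program k)) (i.length + 1) (cfg .setup s i acc [])
      (cfg .backward (backwardStart (sweep setupStep s (i.map fun x => (x, ⊥)) acc).1.first) []
        (sweep setupStep s (i.map fun x => (x, ⊥)) acc).2 []) := by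
  induction i generalizing s acc with
  | nil => exact .single (congrArg some (stepAux_sweepStmt_nil rfl))
  | cons c l ih =>
    refine .head (congrArg some ((stepAux_sweepStmt_cons rfl (by decide)).trans ?_)) (ih _ _)
    erw [update_contents_input, update_contents_left]
    rfl

theorem reaches_backward (s : Registers k) (l acc : List (Cell k)) :
    ReachesInTime (TM2.step (program k)) (l.length + 1) (cfg .backward s [] l acc)
      (cfg .forward (forwardStart (sweep backwardStep s l acc).1.extra) [] []
        (sweep backwardStep s l acc).2) := by
  induction l generalizing s acc with
  | nil => exact .single (congrArg some (stepAux_sweepStmt_nil rfl))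
  | cons c l ih =>
    refine .head (congrArg some ((stepAux_sweepStmt_cons rfl (by decide)).trans ?_)) (ih _ _)
    erw [update_contents_left, update_contents_right]
    rfl

/-- The candidate is tested before the stop criterion `first = ⊤`, so the last candidate, with all
vertices at 0, is tested too. -/
theorem reaches_forward (s : Registers k) (l acc : List (Cell k)) :
    ReachesInTime (TM2.step (program k)) (l.length + 1) (cfg .forward s [] acc l)
      (if Accepts (sweep forwardStep s l acc).1 then
        cfg (.clear true) (sweep forwardStep s l acc).1 [] (sweep forwardStep s l acc).2 []
      else if (sweep forwardStep s l acc).1.first = ⊤ then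
        cfg (.clear false) (sweep forwardStep s l acc).1 [] (sweep forwardStep s l acc).2 []
      else
        cfg .backward (backwardStart (sweep forwardStep s l acc).1.first) []
          (sweep forwardStep s l acc).2 []) := by
  induction l generalizing s acc with
  | nil =>
    refine .single (congrArg some ((stepAux_sweepStmt_nil rfl).trans ?_))
    simp only [sweep, TM2.stepAux]
    by_cases h : Accepts s <;> by_cases h' : s.first = ⊤ <;> simp [cfg, h, h']
  | cons c l ih =>
    refine .head (congrArg some ((stepAux_sweepStmt_cons rfl (by decide)).trans ?_)) (ih _ _)
    erw [update_contents_right, update_contents_left]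
    rfl

/-- `haltList` demands the initial internal state and empty stacks except for the output, hence this
phase. -/
theorem reaches_clear (b : Bool) (s : Registers k) (x : Option (Cell k)) (l : List (Cell k)) :
    ReachesInTime (TM2.step (program k)) (l.length + 1)
      ⟨some (.clear b), (s, x), contents [] l [] []⟩
      ⟨none, (initialRegisters k, none), contents [] [] [] [b]⟩ := by
  induction l generalizing x with
  | nil =>
    refine .single (congrArg some ?_)
    change TM2.Cfg.mk _ _ (Function.update (Function.update _ _ _) _ _) = _
    erw [update_contents_left, update_contents_output]
    rfl
  | cons c l ih =>
    refine .head (congrArg some ?_) (ih (some c))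
    change TM2.Cfg.mk _ _ (Function.update _ _ _) = _
    erw [update_contents_left]
    rfl

end PathMachine

/-! ### Digits in base `n` -/

/-- The numbers `c / n ^ b % n` (`b < m`) are the last digits of `c` in base `n`. -/
theorem pow_dvd_iff_forall_digit_eq_zero {n : ℕ} (c m : ℕ) :
    n ^ m ∣ c ↔ ∀ b < m, c / n ^ b % n = 0 := by
  rcases n.eq_zero_or_pos with rfl | hn
  -- For `n = 0` and `m > 0`, both sides say `c = 0`, because `c / 0 ^ 0 % 0 = c`.
  · cases m with
    | zero => simp
    | succ m =>
      constructor
      · rintro h b -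
        simp [Nat.eq_zero_of_zero_dvd (by simpa using h)]
      · intro h
        have := h 0 m.succ_pos
        simp_all
  induction m with
  | zero => simp
  | succ m ih =>
    rw [Nat.forall_lt_succ_right, ← ih]
    constructor
    · intro h
      have hm : n ^ m ∣ c := (pow_dvd_pow n m.le_succ).trans h
      obtain ⟨e, rfl⟩ := h
      refine ⟨hm, ?_⟩
      rw [pow_succ, mul_assoc, Nat.mul_div_cancel_left _ (pow_pos hn m)]
      simp
    · rintro ⟨⟨e, rfl⟩, h⟩
      rw [Nat.mul_div_cancel_left _ (pow_pos hn m)] at h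
      exact pow_succ n m ▸ mul_dvd_mul_left _ (Nat.dvd_of_mod_eq_zero h)

/-! ### The effect of the sweeps on the work tape -/

namespace PathMachine

variable {k : ℕ}

/-- The row `i` of the work tape, for a graph on `{0, …, n - 1}` with adjacencies `e`, from the
column `j` on; the candidate's vertices at `x` are `o x`. -/
def rowFrom (e : ℕ → ℕ → Bool) (o : ℕ → Marks k) (i j m : ℕ) : List (Cell k) :=
  (List.range' j m).map (fun j => (some (e i j), o j)) ++ [(none, o i)]

/-- The work tape, for a graph on `{0, …, n - 1}` with adjacencies `e`, from the row `i` on. -/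
def tapeFrom (e : ℕ → ℕ → Bool) (n : ℕ) (o : ℕ → Marks k) (i m : ℕ) : List (Cell k) :=
  (List.range' i m).flatMap fun i => rowFrom e o i 0 n

/-- The work tape, for a graph on `{0, …, n - 1}` with adjacencies `e`. -/
def tape (e : ℕ → ℕ → Bool) (n : ℕ) (o : ℕ → Marks k) : List (Cell k) := tapeFrom e n o 0 n

theorem length_tape (e : ℕ → ℕ → Bool) (n : ℕ) (o : ℕ → Marks k) :
    (tape e n o).length = n * (n + 1) := by
  simp [tape, tapeFrom, rowFrom, List.length_flatMap]

theorem tape_congr (e : ℕ → ℕ → Bool) {n : ℕ} {o o' : ℕ → Marks k} (h : ∀ j < n, o j = o' j) :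
    tape e n o = tape e n o' := by
  refine List.flatMap_congr fun i hi => ?_
  simp only [List.mem_range'_1, zero_le, zero_add, true_and] at hi
  simp only [rowFrom, h i hi]
  congr 1
  refine List.map_congr_left fun j hj => ?_
  simp only [List.mem_range'_1, zero_le, zero_add, true_and] at hj
  rw [h j hj]

section sweep

variable (step : Registers k → Cell k → Registers k × Cell k)

theorem sweep_append (s : Registers k) (l l' acc : List (Cell k)) :
    sweep step s (l ++ l') acc = sweep step (sweep step s l acc).1 l' (sweep step s l acc).2 := by
  induction l generalizing s acc with
  | nil => rfl
  | cons c l ih => exact ih _ _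

end sweep

/-- The marks after the vertices of the candidate are moved. -/
def shifted (n : ℕ) (o : ℕ → Marks k) (j : ℕ) : Marks k :=
  shift (o 0) (o ((j + 1) % n)) (o j)

/-- `col` always holds the old marks of the next column to the right. At the right end these are `o
0`, which makes the move cyclic; `j % n` covers this case. -/
theorem sweep_backward_row (e : ℕ → ℕ → Bool) (n : ℕ) (o : ℕ → Marks k) (i j m : ℕ) (hn : j + m = n)
    (y w : Marks k) (a : Fin k → Fin k → Bool) (acc : List (Cell k)) :
    sweep backwardStep ⟨o 0, o 0, y, w, a⟩
        ((List.range' j m).map (fun j => ((some (e i j), o j) : Cell k))).reverse acc =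
      (⟨o 0, o (j % n), y, if 0 < m then shifted n o j else w, a⟩,
        (List.range' j m).map (fun j => ((some (e i j), shifted n o j) : Cell k)) ++ acc) := by
  induction m generalizing j with
  | zero =>
    subst hn
    simp [sweep]
  | succ m ih =>
    have hj : j % n = j := Nat.mod_eq_of_lt (by omega)
    rw [List.range'_succ, List.map_cons, List.reverse_cons, sweep_append, ih (j + 1) (by omega)]
    simp [sweep, backwardStep, hj, shifted]

/-- Column 0 leaves `o 0` in `col`, as the right end of the next row processed requires; `row` does
the same for the ends of rows. The list is reversed because the left stack has the last cell on top.
`extra` ends as the new marks of vertex 0, which become `first`. -/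
theorem sweep_backward_tapeFrom (e : ℕ → ℕ → Bool) (n : ℕ) (o : ℕ → Marks k) (i m : ℕ)
    (hn : i + m = n) (w : Marks k) (a : Fin k → Fin k → Bool) :
    sweep backwardStep ⟨o 0, o 0, o 0, w, a⟩ (tapeFrom e n o i m).reverse [] =
      (⟨o 0, o 0, o (i % n), if 0 < m then shifted n o 0 else w, a⟩,
        tapeFrom e n (shifted n o) i m) := by
  induction m generalizing i with
  | zero =>
    subst hn
    simp [sweep, tapeFrom]
  | succ m ih =>
    have hi : i % n = i := Nat.mod_eq_of_lt (by omega)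
    have hn0 : 0 < n := by omega
    have hcons (o : ℕ → Marks k) : tapeFrom e n o i (m + 1) =
        rowFrom e o i 0 n ++ tapeFrom e n o (i + 1) m := by
      simp [tapeFrom, List.range'_succ]
    rw [hcons, hcons, List.reverse_append, sweep_append, ih (i + 1) (by omega), rowFrom,
      List.reverse_append, sweep_append]
    simp only [sweep, backwardStep, List.reverse_cons, List.reverse_nil, List.nil_append]
    rw [sweep_backward_row e n o i 0 n (zero_add n)]
    simp [hi, hn0, rowFrom, shifted]

theorem sweep_backward_tape (e : ℕ → ℕ → Bool) {n : ℕ} (hn : 0 < n) (o : ℕ → Marks k) :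
    sweep backwardStep (backwardStart (o 0)) (tape e n o).reverse [] =
      (⟨o 0, o 0, o 0, shifted n o 0, ⊥⟩, tape e n (shifted n o)) := by
  simp [backwardStart, tape, sweep_backward_tapeFrom, hn]

theorem sweep_forward_row (e : ℕ → ℕ → Bool) (o : ℕ → Marks k) (i : ℕ) (l : List ℕ)
    (s : Registers k) (acc : List (Cell k)) :
    sweep forwardStep s (l.map fun j => (some (e i j), o j)) acc =
      ({ s with col := fun a => s.col a || l.any fun j => e i j && o j a },
        (l.map fun j => ((some (e i j), o j) : Cell k)).reverse ++ acc) := by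
  induction l generalizing s acc with
  | nil => simp [sweep]
  | cons j l ih => simp [sweep, forwardStep, ih, Bool.or_assoc]

/-- At the end of row `i`, its marks tell who is at `i`, while `col` tells who is at a neighbour of
`i`; together they yield the adjacencies. -/
theorem sweep_forward_rows (e : ℕ → ℕ → Bool) (n : ℕ) (o : ℕ → Marks k) (l : List ℕ)
    (z y : Marks k) (w : Marks k) (r : Fin k → Fin k → Bool) (acc : List (Cell k)) :
    sweep forwardStep ⟨z, ⊥, y, w, r⟩ (l.flatMap fun i => rowFrom e o i 0 n) acc =
      (⟨z, ⊥, y, fun a => w a || l.any fun i => o i a && decide (∃ b ≠ a, o i b),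
        fun a b => r a b || l.any fun i => o i a && (List.range n).any fun j => e i j && o j b⟩,
        (l.flatMap fun i => rowFrom e o i 0 n).reverse ++ acc) := by
  induction l generalizing w r acc with
  | nil => simp [sweep]
  | cons i l ih =>
    rw [List.flatMap_cons, sweep_append, rowFrom, sweep_append, sweep_forward_row]
    simp only [sweep, forwardStep, ih]
    simp [Bool.or_assoc, List.range_eq_range']

/-- `col` is `⊤` only before the first entry of a row, so exactly column 0 gets marked; `decide (j =
0)` expresses both values uniformly. -/
theorem sweep_setup_row (e : ℕ → ℕ → Bool) (i j m : ℕ) (z y w : Marks k)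
    (r : Fin k → Fin k → Bool) (acc : List (Cell k)) :
    sweep setupStep ⟨z, fun _ => decide (j = 0), y, w, r⟩
        ((List.range' j m).map fun j => (some (e i j), ⊥)) acc =
      (⟨z, fun _ => decide (j + m = 0), y, w, r⟩,
        ((List.range' j m).map fun j =>
          ((some (e i j), fun _ => decide (j = 0)) : Cell k)).reverse ++ acc) := by
  induction m generalizing j acc with
  | zero => simp [sweep]
  | succ m ih =>
    have h := ih (j + 1) ((some (e i j), fun _ => decide (j = 0)) :: acc)
    have h0 : (fun _ => decide (j + 1 = 0) : Marks k) = ⊥ := by funext; simp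
    rw [h0] at h
    simp only [List.range'_succ, List.map_cons, sweep, setupStep, h]
    simp

theorem sweep_setup_tapeFrom (e : ℕ → ℕ → Bool) (n : ℕ) (i m : ℕ) (z w : Marks k)
    (r : Fin k → Fin k → Bool) (acc : List (Cell k)) :
    sweep setupStep ⟨z, ⊤, fun _ => decide (i = 0), w, r⟩ (tapeFrom e n ⊥ i m) acc =
      (⟨z, ⊤, fun _ => decide (i + m = 0), w, r⟩,
        (tapeFrom e n (fun j _ => decide (j = 0)) i m).reverse ++ acc) := by
  induction m generalizing i acc with
  | zero => simp [sweep, tapeFrom]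
  | succ m ih =>
    have hcons (o : ℕ → Marks k) : tapeFrom e n o i (m + 1) =
        rowFrom e o i 0 n ++ tapeFrom e n o (i + 1) m := by
      simp [tapeFrom, List.range'_succ]
    have h0 : (fun _ => decide (i + 1 = 0) : Marks k) = ⊥ := by funext; simp
    have h1 := sweep_setup_row e i 0 n z (fun _ => decide (i = 0)) w r acc
    rw [show (fun _ => decide (0 = 0) : Marks k) = ⊤ by funext; simp] at h1
    rw [hcons, hcons, sweep_append, rowFrom, sweep_append]
    have h2 := ih (i + 1)
    rw [h0] at h2
    simp only [Pi.bot_apply, h1, sweep, setupStep, h2]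
    simp [rowFrom]

end PathMachine

/-! ### Enumeration of the candidates -/

namespace PathMachine

variable {k : ℕ}

/-- The candidate with number `c`: its vertices are the last `k` digits of `c` in base `n`. -/
def digits (n k c : ℕ) (a : Fin k) : ℕ := c / n ^ (a : ℕ) % n

/-- The vertices of a candidate at the vertex `j` of the graph. -/
def marks (v : Fin k → ℕ) (j : ℕ) : Marks k := fun a => decide (v a = j)

/-- The candidate is a path in the graph with adjacencies `e`. -/
def IsPathOn (e : ℕ → ℕ → Bool) (v : Fin k → ℕ) : Prop :=
  Function.Injective v ∧ ∀ a b : Fin k, (a : ℕ) + 1 = b → e (v a) (v b)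

/-- Subtraction with borrow: by `Nat.succ_div`, passing from `c + 1` to `c` lowers digit `a`
cyclically exactly if `n ^ a` divides `c + 1`, that is, if all lower digits of `c + 1` are 0. -/
theorem shifted_marks_digits {n j : ℕ} (hj : j < n) (c : ℕ) :
    shifted n (marks (digits n k (c + 1))) j = marks (digits n k c) j := by
  funext a
  have hfirst : (∀ b < a, marks (digits n k (c + 1)) 0 b) ↔ n ^ (a : ℕ) ∣ c + 1 := by
    rw [pow_dvd_iff_forall_digit_eq_zero]
    exact ⟨fun h b hb => of_decide_eq_true (h ⟨b, hb.trans a.2⟩ hb),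
      fun h b hb => decide_eq_true (h b hb)⟩
  simp only [shifted, shift, hfirst]
  simp only [marks, digits, Nat.succ_div]
  split_ifs
  · refine decide_eq_decide.2 ⟨fun h => ?_, fun h => ?_⟩
    · exact (Nat.mod_eq_of_lt hj) ▸ Nat.ModEq.add_right_cancel' 1 h
    · rw [Nat.add_mod, h, Nat.add_mod_mod]
  · rfl

theorem sweep_forward_tape (e : ℕ → ℕ → Bool) (n : ℕ) (z : Marks k) (o : ℕ → Marks k) :
    sweep forwardStep (forwardStart z) (tape e n o) [] =
      (⟨z, ⊥, ⊥, fun a => (List.range n).any fun i => o i a && decide (∃ b ≠ a, o i b),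
        fun a b => (List.range n).any fun i => o i a && (List.range n).any fun j => e i j && o j b⟩,
        (tape e n o).reverse) := by
  simp [forwardStart, tape, tapeFrom, sweep_forward_rows, List.range_eq_range']

theorem accepts_sweep_forward_tape_iff {n : ℕ} (e : ℕ → ℕ → Bool) (z : Marks k) (v : Fin k → ℕ)
    (hv : ∀ a, v a < n) :
    Accepts (sweep forwardStep (forwardStart z) (tape e n (marks v)) []).1 ↔ IsPathOn e v := by
  rw [sweep_forward_tape]
  refine and_congr ?_ (forall₂_congr fun a b => imp_congr_right fun _ => ?_)
  · simp only [funext_iff, Pi.bot_apply, bot_eq_false, List.any_eq_false,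
      List.mem_range, marks, Bool.and_eq_true, decide_eq_true_eq, not_and, not_exists]
    constructor
    · intro h a b hab
      by_contra hne
      exact h b (v b) (hv b) rfl a hne hab
    · rintro h a _ - rfl b hne hab
      exact hne (h hab)
  · simp only [List.any_eq_true, List.mem_range,
      marks, Bool.and_eq_true, decide_eq_true_eq]
    constructor
    · rintro ⟨_, -, rfl, _, -, h, rfl⟩
      exact h
    · exact fun h => ⟨v a, hv a, rfl, v b, hv b, h, rfl⟩

/-- Induction on `c`: a round replaces `c + 1` by `c`, tests it, and either answers or continues
with the smaller candidates. -/
theorem reaches_answer (e : ℕ → ℕ → Bool) {n : ℕ} (hn : 0 < n) (c : ℕ) (hc : c < n ^ k) :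
    ∃ (b : Bool) (s : Registers k) (l : List (Cell k)),
      (b = true ↔ ∃ c' ≤ c, IsPathOn e (digits n k c')) ∧ l.length = n * (n + 1) ∧
      ReachesInTime (TM2.step (program k)) ((c + 1) * (2 * (n * (n + 1) + 1)))
        (cfg .backward (backwardStart (marks (digits n k (c + 1)) 0)) []
          (tape e n (marks (digits n k (c + 1)))).reverse [])
        (cfg (.clear b) s [] l []) := by
  classical
  have hcycle (c : ℕ) : ReachesInTime (TM2.step (program k)) (2 * (n * (n + 1) + 1))
      (cfg .backward (backwardStart (marks (digits n k (c + 1)) 0)) []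
        (tape e n (marks (digits n k (c + 1)))).reverse [])
      (if IsPathOn e (digits n k c) then
        cfg (.clear true) (sweep forwardStep (forwardStart (marks (digits n k c) 0))
          (tape e n (marks (digits n k c))) []).1 [] (tape e n (marks (digits n k c))).reverse []
      else if marks (digits n k c) 0 = ⊤ then
        cfg (.clear false) (sweep forwardStep (forwardStart (marks (digits n k c) 0))
          (tape e n (marks (digits n k c))) []).1 [] (tape e n (marks (digits n k c))).reverse []
      else
        cfg .backward (backwardStart (marks (digits n k c) 0)) []
          (tape e n (marks (digits n k c))).reverse []) := by
    have h₁ := reaches_backward (backwardStart (marks (digits n k (c + 1)) 0))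
      (tape e n (marks (digits n k (c + 1)))).reverse []
    rw [sweep_backward_tape e hn, tape_congr e fun j hj => shifted_marks_digits hj c,
      shifted_marks_digits hn, List.length_reverse, length_tape] at h₁
    have h₂ := reaches_forward (forwardStart (marks (digits n k c) 0))
      (tape e n (marks (digits n k c))) []
    simp only [accepts_sweep_forward_tape_iff e _ (digits n k c) fun a => Nat.mod_lt _ hn] at h₂
    have hfirst : (sweep forwardStep (forwardStart (marks (digits n k c) 0))
        (tape e n (marks (digits n k c))) []).1.first = marks (digits n k c) 0 := by
      rw [sweep_forward_tape]
    have htape : (sweep forwardStep (forwardStart (marks (digits n k c) 0))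
        (tape e n (marks (digits n k c))) []).2 = (tape e n (marks (digits n k c))).reverse := by
      rw [sweep_forward_tape]
    rw [hfirst, htape, length_tape] at h₂
    exact (h₁.trans h₂).mono (by omega)
  have hfirst (c : ℕ) : marks (digits n k c) 0 = ⊤ ↔ n ^ k ∣ c := by
    rw [pow_dvd_iff_forall_digit_eq_zero, funext_iff, Fin.forall_iff]
    exact forall₂_congr fun _ _ => decide_eq_true_iff
  have hlen (c : ℕ) : (tape e n (marks (digits n k c))).reverse.length = n * (n + 1) := by
    rw [List.length_reverse, length_tape]
  induction c with
  | zero =>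
    have h := hcycle 0
    rw [if_pos ((hfirst 0).2 (dvd_zero _))] at h
    split_ifs at h with hp
    · exact ⟨true, _, _, by simpa using hp, hlen 0, h.mono (by omega)⟩
    · exact ⟨false, _, _, by simpa using hp, hlen 0, h.mono (by omega)⟩
  | succ c ih =>
    have h := hcycle (c + 1)
    -- No premature stop: `n ^ k` does not divide a number strictly between 0 and `n ^ k`.
    rw [if_neg (mt (hfirst _).1 (Nat.not_dvd_of_pos_of_lt c.succ_pos hc))] at h
    split_ifs at h with hp
    · exact ⟨true, _, _, by simpa using ⟨c + 1, le_rfl, hp⟩, hlen (c + 1),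
        h.mono (Nat.le_mul_of_pos_left _ (c + 1).succ_pos)⟩
    · obtain ⟨b, s, l, hb, hl, hr⟩ := ih (by omega)
      refine ⟨b, s, l, hb.trans ⟨fun ⟨c', hc', h'⟩ => ⟨c', by omega, h'⟩, ?_⟩, hl,
        (h.trans hr).mono (by rw [add_mul (c + 1) 1, one_mul, add_comm])⟩
      rintro ⟨c', hc', h'⟩
      rcases hc'.lt_or_eq with hlt | rfl
      · exact ⟨c', by omega, h'⟩
      · exact absurd h' hp

theorem exists_isPathOn_digits_iff (e : ℕ → ℕ → Bool) {n : ℕ} (hn : 0 < n) :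
    (∃ c ≤ n ^ k - 1, IsPathOn e (digits n k c)) ↔
      ∃ v : Fin k → Fin n, IsPathOn e fun a => (v a : ℕ) := by
  constructor
  · rintro ⟨c, -, h⟩
    exact ⟨fun a => ⟨digits n k c a, Nat.mod_lt _ hn⟩, h⟩
  · rintro ⟨v, h⟩
    refine ⟨finFunctionFinEquiv v, Nat.le_sub_one_of_lt (finFunctionFinEquiv v).2, ?_⟩
    convert h with a
    conv_rhs => rw [← finFunctionFinEquiv.symm_apply_apply v]
    rfl

/-- With `L = w.length`, setup and clearing take `L + 1` steps each, and at most `n ^ k` rounds take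
`2 * (L + 1)` each; finally `n ≤ L`. -/
theorem machine_outputs (e : ℕ → ℕ → Bool) {n : ℕ} (hn : 0 < n) (w : List (Option Bool))
    (hw : w.map (fun x => (x, ⊥)) = tape e n (⊥ : ℕ → Marks k)) (b : Bool)
    (hb : b = true ↔ ∃ v : Fin k → Fin n, IsPathOn e fun a => (v a : ℕ)) :
    ReachesInTime (TM2.step (program k)) ((2 * w.length ^ k + 2) * (w.length + 1))
      (cfg .setup (initialRegisters k) w [] [])
      ⟨none, (initialRegisters k, none), contents [] [] [] [b]⟩ := by
  have hlen : w.length = n * (n + 1) := by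
    rw [← length_tape e n (⊥ : ℕ → Marks k), ← hw, List.length_map]
  have hpos : 0 < n ^ k := pow_pos hn k
  have h₁ := reaches_setup (initialRegisters k) w []
  have hinit : initialRegisters k = ⟨⊤, ⊤, fun _ => decide (0 = 0), ⊥, ⊥⟩ := by
    simp [initialRegisters]
    rfl
  have hstart (j : ℕ) : marks (digits n k (n ^ k)) j = fun _ => decide (j = 0) := by
    funext a
    have h := (pow_dvd_iff_forall_digit_eq_zero (n ^ k) k).1 dvd_rfl a a.2
    simp only [marks, digits, h, eq_comm]
  have hsetup : sweep setupStep (initialRegisters k) (tape e n ⊥) [] =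
      (⟨⊤, ⊤, fun _ => decide (0 + n = 0), ⊥, ⊥⟩,
        (tape e n (marks (digits n k (n ^ k)))).reverse) := by
    rw [hinit, tape, sweep_setup_tapeFrom, List.append_nil, funext hstart, tape]
  have htop : (⊤ : Marks k) = marks (digits n k (n ^ k)) 0 := by
    rw [hstart]
    rfl
  rw [hw, hsetup, htop] at h₁
  obtain ⟨b', s, l, hb', hl, h₂⟩ := reaches_answer e hn (n ^ k - 1) (Nat.sub_one_lt hpos.ne')
  rw [exists_isPathOn_digits_iff e hn, ← hb, ← Bool.eq_iff_iff] at hb'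
  subst hb'
  rw [Nat.sub_add_cancel hpos] at h₂
  refine ((h₁.trans h₂).trans (reaches_clear b' s none l)).mono ?_
  have hle : n ^ k ≤ w.length ^ k := Nat.pow_le_pow_left (by rw [hlen]; nlinarith) k
  rw [← hlen] at hl ⊢
  rw [hl]
  nlinarith [Nat.mul_le_mul_right (w.length + 1) hle]

end PathMachine

/-! ### Adjacency matrices as work tapes, and the conclusion -/

namespace ConnectedGraph

open Classical in
/-- The adjacencies of a graph on `{0, …, n - 1}`. -/
noncomputable def adjacent (G : ConnectedGraph) (i j : ℕ) : Bool :=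
  decide (∃ (hi : i < G.n) (hj : j < G.n), G.graph.Adj ⟨i, hi⟩ ⟨j, hj⟩)

theorem adjacent_val (G : ConnectedGraph) (i j : Fin G.n) :
    G.adjacent i j = true ↔ G.graph.Adj i j := by
  simp [adjacent]

theorem map_adjacencyString (G : ConnectedGraph) (k : ℕ) :
    G.adjacencyString.map (fun x => (x, ⊥)) =
      PathMachine.tape G.adjacent G.n (⊥ : ℕ → PathMachine.Marks k) := by
  have hrange : List.range' 0 G.n = (List.finRange G.n).map Fin.val := by
    rw [List.map_coe_finRange_eq_range, List.range_eq_range']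
  simp only [adjacencyString, PathMachine.tape, PathMachine.tapeFrom, PathMachine.rowFrom, hrange,
    List.map_flatMap, List.flatMap_map, List.map_map, List.map_append]
  refine List.flatMap_congr fun i _ => congrArg (· ++ _) (List.map_congr_left fun j _ => ?_)
  simp [adjacent]

theorem isYesInstanceDA_iff (G : ConnectedGraph) (d : ℕ) :
    IsYesInstanceDA d G ↔
      ∃ v : Fin (d + 1) → Fin G.n, PathMachine.IsPathOn G.adjacent fun a => (v a : ℕ) := by
  rw [isYesInstanceDA_iff_exists_path]
  refine exists_congr fun v => and_congr ?_ ?_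
  · exact (Fin.val_injective.of_comp_iff v).symm
  · simp only [adjacent_val]

end ConnectedGraph

theorem mainTheorem10 (d : ℕ) (hd : 0 < d) :
    SolvableInPolyTime ConnectedGraph.encoding (IsYesInstanceDA d) := by
  classical
  refine ⟨{ tm := PathMachine.machine (d + 1)
            inputAlphabet := Equiv.refl (Option Bool)
            outputAlphabet := Equiv.refl Bool
            time := (2 * .X ^ (d + 1) + 2) * (.X + 1)
            outputsFun := fun G => Classical.choice ?_ }, ?_⟩
  · have hn : 0 < G.n := Fin.pos_iff_nonempty.2 G.connected.nonempty
    have h := PathMachine.machine_outputs G.adjacent hn G.adjacencyString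
      (G.map_adjacencyString (d + 1)) (decide (IsYesInstanceDA d G))
      (by rw [decide_eq_true_eq, G.isYesInstanceDA_iff])
    have hinput : PathMachine.cfg .setup (PathMachine.initialRegisters (d + 1))
        G.adjacencyString [] [] =
        initList (PathMachine.machine (d + 1)) (List.map (Equiv.refl (Option Bool)).invFun
          (ConnectedGraph.encoding.encode G)) :=
      congrArg (TM2.Cfg.mk _ _) (funext fun s => by
        cases s
        exacts [(List.map_id _).symm, rfl, rfl, rfl])
    have houtput : ⟨none, (PathMachine.initialRegisters (d + 1), none),
        PathMachine.contents [] [] [] [decide (IsYesInstanceDA d G)]⟩ =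
        haltList (PathMachine.machine (d + 1)) (List.map (Equiv.refl Bool).invFun
          (encodeBool (decide (IsYesInstanceDA d G)))) :=
      congrArg (TM2.Cfg.mk _ _) (funext fun s => by cases s <;> rfl)
    have htime (l : ℕ) : (((2 * .X ^ (d + 1) + 2) * (.X + 1) : Polynomial ℕ)).eval l =
        (2 * l ^ (d + 1) + 2) * (l + 1) := by
      simp
    rw [htime]
    exact h.congr hinput houtput
  · exact fun
      | .input => inferInstanceAs (Finite (Option Bool))
      | .left => inferInstanceAs (Finite (PathMachine.Cell (d + 1)))
      | .right => inferInstanceAs (Finite (PathMachine.Cell (d + 1)))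
      | .output => inferInstanceAs (Finite Bool)
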